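/- **Setting.** There are $n=3f+1$ nodes, at most $f$ of them Byzantine, the others correct. Every block $X$ has a round, a creator, an ordered list of references to blocks of earlier rounds, a list of transactions, and explicit votes for transactions in blocks; a block of round $r\ge 1$ references blocks of round $r-1$ from at least $2f+1$ nodes. $\mathrm{Cone}(X)$ is the set of blocks reachable from $X$ (including $X$). A *quorum* is a set of blocks from at least $2f+1$ different nodes. Any two blocks of a correct node are linearly ordered: the one of smaller round is in the cone of the other, and there is at most one per round. The local DAG of a correct node only grows and contains the cones of its blocks. Two different transactions form a *double spend* if they consume a common object; an input object is *confirmed* if it is an initial object or an output of a confirmed transaction. **Mysticeti-C.** $X$ *votes* for a block $Y$ of the previous round if $Y$ is the first block of its creator in its round in the depth-first traversal of $X$. $X$ is a *block certificate* for $Y$ if $Y.\mathrm{round}=X.\mathrm{round}-2$ and $\mathrm{Cone}(X)$ contains a quorum of blocks voting for $Y$. All nodes agree on a sequence of distinct leader slots (pairs of a node and a round), listed by nondecreasing rounds. In a DAG $G$, a leader block $L$ is *directly committed* if $G$ contains a quorum of block certificates for $L$; a slot of round $r$ is *directly skipped* if $G$ contains a quorum of blocks of round $r+1$ that vote for no block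 of this slot. Further, if the first slot of round at least $r+3$ that is not skipped has a committed block $A$, then a slot of round $r$ is decided indirectly: its leader block $L$ is committed if $\mathrm{Cone}(A)$ contains a block certificate for $L$, and the slot is skipped if $\mathrm{Cone}(A)$ contains no block certificate for a block of the slot. The *backbone chain* $L_1,L_2,\dots$ of $G$ consists of the committed leader blocks in slot order, up to the first undecided slot. $C(L_i)$ is $L_j$ with minimal $j>i$ such that $L_i$ is committed in the DAG $\mathrm{Cone}(L_j)$, and $D(L_i)$ is $L_j$ with minimal $j\ge i$ such that $L_j$ is directly committed in $\mathrm{Cone}(C(L_i))$. **Confirmation.** $X$ is a *transaction certificate* for $tx$ in block $B$ if $B.\mathrm{round}=X.\mathrm{round}-2$ and $\mathrm{Cone}(X)$ contains blocks from $2f+1$ nodes including a vote for $tx$ in $B$. 1. *Fast path*: $tx$ in $B$ is confirmed in a DAG containing transaction certificates for $tx$ in $B$ from $2f+1$ nodes. 2. *Consensus path*: start with no confirmed transaction, go through the backbone chain, and for each new block $C=C(L)$ run first 2a for $C$ and then 2b for every new $D=D(L)$ with $C(L)=C$. The blocks of a cone are traversed in an agreed total order that extends the causal order, and a transaction *can be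 confirmed* if all its input objects are confirmed and no double spend of it is confirmed by the consensus path so far. - *2a*: for every block $B\in\mathrm{Cone}(C)$ with $B.\mathrm{round}\le C.\mathrm{round}-3$ and every $tx$ in $B$ with at least one transaction certificate in $\mathrm{Cone}(C)$, confirm $tx$ if it can be confirmed. - *2b*: for every transaction in a block of $\mathrm{Cone}(D)$, confirm it if it can be confirmed. A transaction is *confirmed in a DAG* if it is confirmed there by the fast path or by the consensus path. A correct node votes in its block $X$ for $tx$ in $B$ only if $B\in\mathrm{Cone}(X)$, $B$ contains $tx$, the input objects of $tx$ are confirmed in the DAG $\mathrm{Cone}(B)$, and no block of $\mathrm{Cone}(X)$ contains a double spend of $tx$. **Lemma.** Suppose that $tx$ in block $B$ is fast-path confirmed in the local DAG of some correct node at some time. Then, for every correct node $u$: (i) whenever $u$ processes a block $C=C(L)$ with $C.\mathrm{round}\ge B.\mathrm{round}+3$, the transaction $tx$ in $B$ is confirmed through path 2a for $C$ (it has a certificate in $\mathrm{Cone}(C)$, and at its turn it can be confirmed); (ii) no double spend of $tx$ is ever confirmed at $u$, by any of the three paths; (iii) from some time on, $tx$ in $B$ is confirmed at $u$ through consensus path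 2a, provided that the network is eventually lock-step synchronous (correct nodes create a block in every round, each of their blocks eventually reaches all correct nodes, and from some unknown round on each block of a correct node references all blocks of correct nodes of the previous round) and that the leader schedule is fair (for infinitely many $R$ the first leader slots of the rounds $R,R+1,R+2$ belong to correct nodes, as for example with a rotating leader). -/

import Mathlib

namespace MysticetiFPC

/-- The data of a run of the modified Mysticeti-FPC protocol: the fault bound `f`, the transactions
(with the objects they consume and create), all well-formed blocks that ever exist in the run, the
agreed schedule of leader slots (slot number `s` is the pair `(slotNode s, slotRound s)`), and the
agreed deterministic total order in which the blocks of a past cone are traversed.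
No law is imposed here; the laws are collected in `Setup.IsExecution`. -/
structure Setup (Node Tx Obj Block : Type*) where
  /-- the bound on the number of Byzantine nodes -/
  f : ℕ
  /-- the objects consumed by a transaction -/
  inputs : Tx → Set Obj
  /-- the objects created by a transaction -/
  outputs : Tx → Set Obj
  /-- the objects that exist from the beginning -/
  initial : Set Obj
  /-- the round of a block -/
  round : Block → ℕ
  /-- the creator of a block -/
  author : Block → Node
  /-- the blocks referenced by a block, in the order in which the block lists them -/
  refs : Block → List Block
  /-- the transactions contained in a block -/
  txs : Block → List Tx
  /-- the explicit votes in a block: `(B, tx)` is a vote for the transaction `tx` in block `B` -/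
  votes : Block → Set (Block × Tx)
  /-- the round of a leader slot -/
  slotRound : ℕ → ℕ
  /-- the designated node of a leader slot -/
  slotNode : ℕ → Node
  /-- the traversal order of the past cone of a block -/
  order : Block → List Block

namespace Setup

variable {Node Tx Obj Block : Type*} (S : Setup Node Tx Obj Block)

/-! ### Blocks, cones, quorums -/

/-- The past cone (causal history) of `X`: all blocks reachable from `X`, including `X`. -/
def Cone (X : Block) : Set Block :=
  {Y | Relation.ReflTransGen (fun a b => b ∈ S.refs a) X Y}

/-- The blocks satisfying `P` form a quorum: they come from at least `2f+1` different nodes. -/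
def Quorum (P : Block → Prop) : Prop :=
  2 * S.f + 1 ≤ {v : Node | ∃ X, S.author X = v ∧ P X}.ncard

/-- Depth-first (preorder) traversal of the cone of a block, following references to depth `k`.
Blocks that are met again are listed again, which does not affect first occurrences. -/
def dfsAux : ℕ → Block → List Block
  | 0, X => [X]
  | k + 1, X => X :: (S.refs X).flatMap (dfsAux k)

/-- The depth-first traversal of `X`. References lower the round, so depth `round X` is enough. -/
def dfs (X : Block) : List Block := S.dfsAux (S.round X) X

/-! ### Mysticeti-C: block votes, block certificates, commit rule -/

open Classical in
/-- `X` votes for the block `Y` of the previous round: `Y` is the first block of its creator in its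
round that is met in the depth-first traversal of `X`. -/
def BlockVote (X Y : Block) : Prop :=
  S.round Y + 1 = S.round X ∧
    (S.dfs X).find? (fun Z => decide (S.author Z = S.author Y ∧ S.round Z = S.round Y)) = some Y

/-- `X` is a block certificate for `Y`. -/
def BlockCert (X Y : Block) : Prop :=
  S.round Y + 2 = S.round X ∧ S.Quorum (fun Z => Z ∈ S.Cone X ∧ S.BlockVote Z Y)

/-- `L` is a leader block of leader slot `s` (a Byzantine leader may create several). -/
def LeaderOf (s : ℕ) (L : Block) : Prop :=
  S.author L = S.slotNode s ∧ S.round L = S.slotRound s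

/-- `L` is directly committed in the DAG `G`: `G` contains a quorum of block certificates for `L`. -/
def DirectCommit (G : Set Block) (L : Block) : Prop :=
  S.Quorum (fun X => X ∈ G ∧ S.BlockCert X L)

/-- Slot `s` is directly skipped in `G`: a quorum of blocks of the next round vote for no block of
this slot. -/
def DirectSkip (G : Set Block) (s : ℕ) : Prop :=
  S.Quorum (fun X => X ∈ G ∧ S.round X = S.slotRound s + 1 ∧
    ∀ L, S.LeaderOf s L → ¬ S.BlockVote X L)

/-- The decision rule of Mysticeti-C in the DAG `G`. `Decides G s (some L)` says that the leader
block `L` of slot `s` is committed, `Decides G s none` says that slot `s` is skipped; a slot may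
also be undecided. The anchor of slot `s` is the first leader slot at least three rounds later that
is not skipped; if a block `A` is committed in it, then slot `s` is decided by whether the causal
history of `A` contains a block certificate for a leader block of slot `s`. -/
inductive Decides (G : Set Block) : ℕ → Option Block → Prop
  | directCommit (s : ℕ) (L : Block) (hL : S.LeaderOf s L) (h : S.DirectCommit G L) :
      Decides G s (some L)
  | directSkip (s : ℕ) (h : S.DirectSkip G s) : Decides G s none
  | indirectCommit (s a : ℕ) (A L X : Block) (ha : S.slotRound s + 3 ≤ S.slotRound a)
      (hA : Decides G a (some A))
      (hskip : ∀ k, S.slotRound s + 3 ≤ S.slotRound k → k < a → Decides G k none)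
      (hL : S.LeaderOf s L) (hX : X ∈ S.Cone A) (hcert : S.BlockCert X L) :
      Decides G s (some L)
  | indirectSkip (s a : ℕ) (A : Block) (ha : S.slotRound s + 3 ≤ S.slotRound a)
      (hA : Decides G a (some A))
      (hskip : ∀ k, S.slotRound s + 3 ≤ S.slotRound k → k < a → Decides G k none)
      (hno : ∀ L X, S.LeaderOf s L → X ∈ S.Cone A → ¬ S.BlockCert X L) :
      Decides G s none

/-- `L` is the block of slot `s` in the backbone chain of committed leader blocks determined by the
DAG `G`: it is committed and all earlier slots are decided. The backbone chain `L₁, L₂, …` is listed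
by increasing slot number, so that comparing indices in the chain is comparing slots. -/
def Backbone (G : Set Block) (s : ℕ) (L : Block) : Prop :=
  S.Decides G s (some L) ∧ ∀ k < s, ∃ d, S.Decides G k d

/-- For the backbone block `L` in slot `i`: `C` is the backbone block `C(L)` and stands in slot `j`,
i.e. it is the first later backbone block such that `L` is committed in `Cone C`. -/
def IsC (G : Set Block) (i j : ℕ) (C : Block) : Prop :=
  ∃ L, S.Backbone G i L ∧ S.Backbone G j C ∧ i < j ∧ S.Decides (S.Cone C) i (some L) ∧
    ∀ k K, i < k → k < j → S.Backbone G k K → ¬ S.Decides (S.Cone K) i (some L)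

/-- For the backbone block `L` in slot `i`: `D` is the backbone block `D(L)`, i.e. the first backbone
block from `L` on that is directly committed in `Cone (C(L))`. -/
def IsD (G : Set Block) (i : ℕ) (D : Block) : Prop :=
  ∃ j C d, S.IsC G i j C ∧ i ≤ d ∧ S.Backbone G d D ∧ S.DirectCommit (S.Cone C) D ∧
    ∀ k K, i ≤ k → k < d → S.Backbone G k K → ¬ S.DirectCommit (S.Cone C) K

open Classical in
/-- The block in slot `j` of the backbone chain of `G`, if it is `C(L)` for some backbone block `L`. -/
noncomputable def newC (G : Set Block) (j : ℕ) : Option Block :=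
  if h : ∃ C i, S.IsC G i j C then some h.choose else none

open Classical in
/-- `D(L)` for the backbone block `L` in slot `i`, if it is determined by `G`. -/
noncomputable def dOf (G : Set Block) (i : ℕ) : Option Block :=
  if h : ∃ D, S.IsD G i D then some h.choose else none

/-! ### Transactions: double spends, certificates, fast path -/

/-- Two different transactions that consume a common object. -/
def DoubleSpend (tx tx' : Tx) : Prop :=
  tx ≠ tx' ∧ (S.inputs tx ∩ S.inputs tx').Nonempty

/-- Relative to a set `K` of confirmed transactions, all input objects of `tx` are confirmed. -/
def InputsConfirmed (K : Set Tx) (tx : Tx) : Prop :=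
  ∀ o ∈ S.inputs tx, o ∈ S.initial ∨ ∃ p ∈ K, o ∈ S.outputs p

/-- Relative to a set `K` of confirmed transactions, `tx` can be confirmed: all its input objects are
confirmed and no double spend of it is confirmed. -/
def Possible (K : Set Tx) (tx : Tx) : Prop :=
  S.InputsConfirmed K tx ∧ ∀ tx' ∈ K, ¬ S.DoubleSpend tx tx'

/-- `X` is a transaction certificate for the transaction `tx` in block `B`: it is created exactly two
rounds after `B` and its cone contains votes for `tx` in `B` from at least `2f+1` nodes. -/
def TxCert (X B : Block) (tx : Tx) : Prop :=
  S.round B + 2 = S.round X ∧ S.Quorum (fun Y => Y ∈ S.Cone X ∧ (B, tx) ∈ S.votes Y)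

/-- Path 1: `tx` in block `B` is fast-path confirmed in `G`. -/
def FastConfirmed (G : Set Block) (B : Block) (tx : Tx) : Prop :=
  S.Quorum (fun X => X ∈ G ∧ S.TxCert X B tx)

/-! ### Consensus paths 2a and 2b -/

/-- All transactions, together with the blocks containing them, in the cone of `C`, in the agreed
order. -/
def entries (C : Block) : List (Block × Tx) :=
  (S.order C).flatMap (fun Y => (S.txs Y).map (fun tx => (Y, tx)))

/-- `tx` in block `B` is examined in path 2a for `C` and has a transaction certificate there. -/
def Eligible (C B : Block) (tx : Tx) : Prop :=
  S.round B + 3 ≤ S.round C ∧ ∃ X ∈ S.Cone C, S.TxCert X B tx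

/-- One step of path 2a for `C`: the examined transaction is added to the confirmed ones if it has a
certificate in `Cone C` and it can be confirmed. -/
def step2a (C : Block) (K : Set Tx) (e : Block × Tx) : Set Tx :=
  {x | x ∈ K ∨ (x = e.2 ∧ S.Eligible C e.1 e.2 ∧ S.Possible K e.2)}

/-- One step of path 2b: the transaction is added to the confirmed ones if it can be confirmed. -/
def step2b (K : Set Tx) (e : Block × Tx) : Set Tx :=
  {x | x ∈ K ∨ (x = e.2 ∧ S.Possible K e.2)}

/-- The whole of path 2a for `C`. -/
def pass2a (C : Block) (K : Set Tx) : Set Tx := (S.entries C).foldl (S.step2a C) K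

/-- The whole of path 2b for `D`. -/
def pass2b (D : Block) (K : Set Tx) : Set Tx := (S.entries D).foldl S.step2b K

open Classical in
/-- Path 2b for `D(L)`, where `L` stands in slot `i`, unless `D(L)` was treated before. The state is
the set of confirmed transactions together with the set of blocks `D` already treated. -/
noncomputable def stepD (G : Set Block) (j : ℕ) (st : Set Tx × Set Block) (i : ℕ) :
    Set Tx × Set Block :=
  if ∃ C, S.IsC G i j C then
    match S.dOf G i with
    | some D => if D ∈ st.2 then st else (S.pass2b D st.1, insert D st.2)
    | none => st
  else st

/-- The state of the consensus path after the backbone slots `0, …, j-1` have been processed. When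
the backbone block `C` in a slot is `C(L)` for some `L`, path 2a is run for `C`, and then path 2b is
run for every new block `D(L)` with `C(L) = C`. -/
noncomputable def consState (G : Set Block) : ℕ → Set Tx × Set Block
  | 0 => (∅, ∅)
  | j + 1 =>
    match S.newC G j with
    | some C => (List.range j).foldl (S.stepD G j)
        (S.pass2a C (consState G j).1, (consState G j).2)
    | none => consState G j

/-- `tx` is confirmed in the DAG `G`: by path 1 or by the consensus paths 2a and 2b. -/
def Confirmed (G : Set Block) (tx : Tx) : Prop :=
  (∃ B, S.FastConfirmed G B tx) ∨ ∃ j, tx ∈ (S.consState G j).1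

/-- `tx` in block `B` is confirmed through path 2a when the block `C` in slot `j` is processed: it
has a certificate, and when its turn comes, it can be confirmed. -/
def Confirmed2aAt (G : Set Block) (j : ℕ) (C B : Block) (tx : Tx) : Prop :=
  S.newC G j = some C ∧ S.Eligible C B tx ∧
    ∃ pre post, S.entries C = pre ++ (B, tx) :: post ∧
      S.Possible (pre.foldl (S.step2a C) (S.consState G j).1) tx

/-- `tx` in block `B` is confirmed through path 2a by a node with local DAG `G`. -/
def Confirmed2a (G : Set Block) (B : Block) (tx : Tx) : Prop :=
  ∃ j C, S.Confirmed2aAt G j C B tx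

/-! ### Executions -/

/-- Block `X` may vote for `tx` in `B`: `B` contains `tx` and is in the cone of `X`, the input objects
of `tx` are confirmed in `Cone B`, and no block in the cone of `X` contains a double spend of `tx`. -/
def Approves (X B : Block) (tx : Tx) : Prop :=
  B ∈ S.Cone X ∧ tx ∈ S.txs B ∧ S.InputsConfirmed {p | S.Confirmed (S.Cone B) p} tx ∧
    ∀ Y ∈ S.Cone X, ∀ tx' ∈ S.txs Y, ¬ S.DoubleSpend tx tx'

/-- The rules of the protocol. `correct` is the set of correct nodes and `dag u t` is the local DAG of
node `u` at time `t`. Nothing is required of Byzantine nodes, except that badly formed blocks are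
ignored. -/
structure IsExecution (correct : Set Node) (dag : Node → ℕ → Set Block) : Prop where
  card_nodes : Nat.card Node = 3 * S.f + 1
  card_faulty : (correctᶜ).ncard ≤ S.f
  /-- references go to earlier rounds -/
  refs_round : ∀ X, ∀ Y ∈ S.refs X, S.round Y < S.round X
  /-- a block after round `0` references blocks of `2f+1` nodes from the previous round -/
  refs_quorum : ∀ X, S.round X ≠ 0 →
    S.Quorum (fun Y => Y ∈ S.refs X ∧ S.round Y + 1 = S.round X)
  /-- leader slots are listed by rounds, without repetition -/
  slot_mono : Monotone S.slotRound
  slot_inj : Function.Injective (fun s => (S.slotNode s, S.slotRound s))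
  /-- the agreed order lists the cone of a block, causes before effects -/
  order_mem : ∀ C Y, Y ∈ S.order C ↔ Y ∈ S.Cone C
  order_causal : ∀ C, (S.order C).Pairwise (fun Y Z => Z ∉ S.Cone Y)
  /-- the blocks of a correct node are linearly ordered: each one has all the previous ones in its
  cone (so there is at most one in every round) -/
  correct_linear : ∀ X Y, S.author X = S.author Y → S.author X ∈ correct →
    S.round Y ≤ S.round X → Y ∈ S.Cone X
  /-- correct nodes vote only for what they may approve -/
  correct_votes : ∀ X B tx, S.author X ∈ correct → (B, tx) ∈ S.votes X → S.Approves X B tx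
  /-- local DAGs grow and contain the causal history of their blocks -/
  dag_mono : ∀ u ∈ correct, Monotone (dag u)
  dag_closed : ∀ u ∈ correct, ∀ t, ∀ X ∈ dag u t, S.Cone X ⊆ dag u t

/-- Eventual lock-step synchrony: correct nodes create a block in every round, all blocks of correct
nodes eventually reach all correct nodes, and from some unknown round on, every block of a correct
node references all blocks of correct nodes from the previous round. -/
structure EventuallySynchronous (correct : Set Node) (dag : Node → ℕ → Set Block) : Prop where
  produces : ∀ v ∈ correct, ∀ r, ∃ X, S.author X = v ∧ S.round X = r
  delivers : ∀ X, S.author X ∈ correct → ∀ u ∈ correct, ∃ t, X ∈ dag u t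
  synchronous : ∃ gst, ∀ X Y, S.author X ∈ correct → S.author Y ∈ correct →
    gst ≤ S.round Y → S.round X = S.round Y + 1 → Y ∈ S.refs X

/-- The leader schedule is fair: again and again there are three consecutive rounds whose first
leader slots belong to correct nodes. For instance, this holds whenever the first leader slots of
rounds `0, 1, 2, …` rotate through all `3f+1` nodes. -/
def FairSchedule (correct : Set Node) : Prop :=
  ∀ R₀, ∃ R ≥ R₀, ∀ k < 3, ∃ s, S.slotRound s = R + k ∧
    (∀ s', S.slotRound s' = R + k → s ≤ s') ∧ S.slotNode s ∈ correct

end Setup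

end MysticetiFPC

namespace MysticetiFPC

namespace Setup

variable {Node Tx Obj Block : Type*} {S : Setup Node Tx Obj Block}
  {correct : Set Node} {dag : Node → ℕ → Set Block}

/-! ### Cones -/

/-! Everything rests on quorum intersection: two quorums share a correct node (`quorum_inter`), and
the blocks of that node form a chain. Hence DAGs agree on every slot they both decide
(`decides_unique`), and two double spends are never both certified (`txCert_not_doubleSpend`).

Safety. A fast-path quorum of certificates in round `B.round + 2` meets every cone that reaches
three rounds above `B`, so `tx` is eligible in path 2a. Its inputs are confirmed by its turn, by
induction on the round of `B`: an input known in `Cone B` comes either from the fast path, hence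
from an earlier entry, or from the consensus path of `Cone B`, whose steps every DAG has run before
reaching `C` (`possible_of_fastConfirmed`). Path 2a adds only certified transactions, hence no
conflicts. For path 2b on `D`, either `C` is at least three rounds above `B` and 2a has already
confirmed `tx`, which blocks its double spends, or `D` is so old that a correct voter for `tx` has
`D` in its cone and would have noticed a double spend there (`not_doubleSpend_of_directCommit`).
Induction over slots gives `conflictFree_consState`.

Liveness. After stabilization correct leaders are directly committed; three consecutive ones decide
everything before them, so blocks `C(L)` of arbitrarily high round are processed (`exists_newC`). -/

theorem mem_cone_self (X : Block) : X ∈ S.Cone X := Relation.ReflTransGen.refl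

theorem mem_cone_trans {X Y Z : Block} (hXY : Y ∈ S.Cone X) (hYZ : Z ∈ S.Cone Y) :
    Z ∈ S.Cone X := Relation.ReflTransGen.trans hXY hYZ

theorem mem_cone_of_mem_refs {X Y : Block} (hXY : Y ∈ S.refs X) : Y ∈ S.Cone X :=
  Relation.ReflTransGen.single hXY

theorem DoubleSpend.symm {tx tx' : Tx} (h : S.DoubleSpend tx tx') : S.DoubleSpend tx' tx :=
  ⟨h.1.symm, by rw [Set.inter_comm]; exact h.2⟩

theorem mem_cone_of_mem_dfsAux (k : ℕ) : ∀ {X Y : Block}, Y ∈ S.dfsAux k X → Y ∈ S.Cone X := by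
  induction k with
  | zero =>
    intro X Y h
    simp only [dfsAux, List.mem_singleton] at h
    exact h ▸ mem_cone_self Y
  | succ k ih =>
    intro X Y h
    simp only [dfsAux, List.mem_cons, List.mem_flatMap] at h
    rcases h with rfl | ⟨Z, hZ, hY⟩
    · exact mem_cone_self _
    · exact mem_cone_trans (mem_cone_of_mem_refs hZ) (ih hY)

theorem self_mem_dfsAux (k : ℕ) (X : Block) : X ∈ S.dfsAux k X := by
  cases k <;> simp [dfsAux]

theorem BlockVote.mem_cone {X Y : Block} (h : S.BlockVote X Y) : Y ∈ S.Cone X :=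
  mem_cone_of_mem_dfsAux _ (List.mem_of_find?_eq_some h.2)

theorem BlockVote.eq {X Y Y' : Block} (h : S.BlockVote X Y) (h' : S.BlockVote X Y')
    (ha : S.author Y = S.author Y') (hr : S.round Y = S.round Y') : Y = Y' := by
  have h1 := h.2
  have h2 := h'.2
  rw [ha, hr, h2] at h1
  exact (Option.some.inj h1).symm

theorem Decides.leaderOf {G : Set Block} {s : ℕ} {L : Block} (h : S.Decides G s (some L)) :
    S.LeaderOf s L := by
  cases h <;> assumption

theorem mem_entries {C Y : Block} {tx : Tx} :
    (Y, tx) ∈ S.entries C ↔ Y ∈ S.order C ∧ tx ∈ S.txs Y := by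
  simp only [entries, List.mem_flatMap, List.mem_map, Prod.mk.injEq]
  constructor
  · rintro ⟨Z, hZ, t, ht, rfl, rfl⟩
    exact ⟨hZ, ht⟩
  · rintro ⟨hY, ht⟩
    exact ⟨Y, hY, tx, ht, rfl, rfl⟩

/-! ### Monotonicity of the consensus path -/

theorem subset_foldl {α β : Type*} {g : Set α → β → Set α} (hg : ∀ K e, K ⊆ g K e)
    (l : List β) : ∀ K, K ⊆ l.foldl g K := by
  induction l with
  | nil => exact fun K => subset_rfl
  | cons e l ih => exact fun K => (hg K e).trans (ih _)

theorem subset_foldl_step2a (C : Block) (l : List (Block × Tx)) (K : Set Tx) :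
    K ⊆ l.foldl (S.step2a C) K :=
  subset_foldl (fun _ _ _ hx => Or.inl hx) l K

theorem subset_foldl_step2b (l : List (Block × Tx)) (K : Set Tx) :
    K ⊆ l.foldl S.step2b K :=
  subset_foldl (fun _ _ _ hx => Or.inl hx) l K

theorem mem_foldl_step2a {C : Block} {x : Tx} (l : List (Block × Tx)) : ∀ {K : Set Tx},
    x ∈ l.foldl (S.step2a C) K → x ∈ K ∨ ∃ B, S.Eligible C B x := by
  induction l with
  | nil => exact fun h => Or.inl h
  | cons e l ih =>
    intro K h
    rcases ih h with (h | ⟨rfl, h, -⟩) | h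
    · exact Or.inl h
    · exact Or.inr ⟨_, h⟩
    · exact Or.inr h

theorem subset_stepD (G : Set Block) (j : ℕ) (st : Set Tx × Set Block) (i : ℕ) :
    st.1 ⊆ (S.stepD G j st i).1 := by
  unfold stepD
  split_ifs
  · split
    · split_ifs
      · exact subset_rfl
      · exact subset_foldl_step2b _ _
    · exact subset_rfl
  · exact subset_rfl

theorem subset_foldl_stepD (G : Set Block) (j : ℕ) (l : List ℕ) : ∀ st : Set Tx × Set Block,
    st.1 ⊆ (l.foldl (S.stepD G j) st).1 := by
  induction l with
  | nil => exact fun st => subset_rfl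
  | cons i l ih => exact fun st => (subset_stepD G j st i).trans (ih _)

theorem consState_mono (G : Set Block) : Monotone fun j => (S.consState G j).1 := by
  refine monotone_nat_of_le_succ fun j => ?_
  simp only [consState]
  split
  · exact Set.Subset.trans (subset_foldl_step2a _ _ _)
      (subset_foldl_stepD G j _ (S.pass2a _ (S.consState G j).1, (S.consState G j).2))
  · exact subset_rfl

/-- No transaction in `K` is a double spend of a fast-path confirmed one. -/
def ConflictFree (S : Setup Node Tx Obj Block) (K : Set Tx) : Prop :=
  ∀ G B tx, S.FastConfirmed G B tx → ∀ tx' ∈ K, ¬ S.DoubleSpend tx tx'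

namespace IsExecution

/-! ### Quorums -/

theorem finite_node (h : S.IsExecution correct dag) : Finite Node :=
  Nat.finite_of_card_ne_zero (by rw [h.card_nodes]; omega)

theorem quorum_mono (h : S.IsExecution correct dag) {P Q : Block → Prop}
    (hPQ : ∀ X, P X → Q X) (hP : S.Quorum P) : S.Quorum Q := by
  have := h.finite_node
  exact hP.trans (Set.ncard_le_ncard (fun v ⟨X, hX, hp⟩ => ⟨X, hX, hPQ X hp⟩) (Set.toFinite _))

/-- Two quorums have a correct node in common. -/
theorem quorum_inter (h : S.IsExecution correct dag) {P Q : Block → Prop}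
    (hP : S.Quorum P) (hQ : S.Quorum Q) :
    ∃ X Y, S.author X = S.author Y ∧ S.author X ∈ correct ∧ P X ∧ Q Y := by
  have := h.finite_node
  unfold Quorum at hP hQ
  set s := {v : Node | ∃ X, S.author X = v ∧ P X}
  set t := {v : Node | ∃ X, S.author X = v ∧ Q X}
  have h1 := Set.ncard_union_add_ncard_inter s t
  have h2 : (s ∪ t).ncard ≤ 3 * S.f + 1 := by
    rw [← h.card_nodes, ← Set.ncard_univ]
    exact Set.ncard_le_ncard (Set.subset_univ _)
  -- The intersection has at least `2(2f+1) - (3f+1) = f+1` nodes, more than the faulty ones.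
  have h3 : ¬ s ∩ t ⊆ correctᶜ := fun hs => by
    have h4 := Set.ncard_le_ncard hs
    have h5 := h.card_faulty
    omega
  obtain ⟨v, ⟨⟨X, hX, hp⟩, ⟨Y, hY, hq⟩⟩, hv⟩ := Set.not_subset.1 h3
  exact ⟨X, Y, hX.trans hY.symm, hX ▸ not_not.1 hv, hp, hq⟩

theorem quorum_exists (h : S.IsExecution correct dag) {P : Block → Prop} (hP : S.Quorum P) :
    ∃ X, S.author X ∈ correct ∧ P X := by
  obtain ⟨X, -, -, hX, hp, -⟩ := h.quorum_inter hP hP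
  exact ⟨X, hX, hp⟩

theorem quorum_of_correct (h : S.IsExecution correct dag) {P : Block → Prop}
    (hP : ∀ v ∈ correct, ∃ X, S.author X = v ∧ P X) : S.Quorum P := by
  have := h.finite_node
  have h1 : correct.ncard ≤ {v : Node | ∃ X, S.author X = v ∧ P X}.ncard :=
    Set.ncard_le_ncard hP
  have h2 := Set.ncard_add_ncard_compl correct
  have h3 := h.card_faulty
  rw [h.card_nodes] at h2
  unfold Quorum
  omega

/-! ### Rounds -/

theorem round_le (h : S.IsExecution correct dag) {X Y : Block} (hY : Y ∈ S.Cone X) :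
    S.round Y ≤ S.round X := by
  induction hY with
  | refl => exact le_rfl
  | tail _ hb ih => exact (h.refs_round _ _ hb).le.trans ih

theorem eq_of_mem_cone (h : S.IsExecution correct dag) {X Y : Block} (hY : Y ∈ S.Cone X)
    (hr : S.round X ≤ S.round Y) : Y = X := by
  rcases Relation.ReflTransGen.cases_head hY with h1 | ⟨Z, hZ, hZY⟩
  · exact h1.symm
  · have h1 := h.refs_round _ _ hZ
    have h2 := h.round_le hZY
    omega

theorem eq_of_correct (h : S.IsExecution correct dag) {X Y : Block}
    (ha : S.author X = S.author Y) (hc : S.author X ∈ correct) (hr : S.round X = S.round Y) :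
    X = Y :=
  (h.eq_of_mem_cone (h.correct_linear X Y ha hc hr.ge) hr.le).symm

/-- Below every block there is a quorum in each earlier round. -/
theorem quorum_round (h : S.IsExecution correct dag) {r : ℕ} : ∀ {X : Block}, r < S.round X →
    S.Quorum (fun Y => Y ∈ S.Cone X ∧ S.round Y = r) := by
  suffices ∀ n X, S.round X = r + 1 + n → S.Quorum (fun Y => Y ∈ S.Cone X ∧ S.round Y = r) from
    fun {X} hX => this (S.round X - (r + 1)) X (by omega)
  intro n
  induction n with
  | zero =>
    intro X hX
    exact h.quorum_mono (fun Y hY => ⟨mem_cone_of_mem_refs hY.1, by omega⟩)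
      (h.refs_quorum X (by omega))
  | succ n ih =>
    intro X hX
    obtain ⟨Z, -, hZ, hr⟩ := h.quorum_exists (h.refs_quorum X (by omega))
    exact h.quorum_mono (fun Y hY => ⟨mem_cone_trans (mem_cone_of_mem_refs hZ) hY.1, hY.2⟩)
      (ih Z (by omega))

/-- The cone of a later block meets every quorum of blocks of a given round. -/
theorem exists_mem_cone (h : S.IsExecution correct dag) {P : Block → Prop} (hP : S.Quorum P)
    {r : ℕ} (hPr : ∀ X, P X → S.round X = r) {A : Block} (hA : r < S.round A) :
    ∃ X ∈ S.Cone A, P X := by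
  obtain ⟨X, Y, ha, hc, hX, hYA, hY⟩ := h.quorum_inter hP (h.quorum_round hA)
  rw [← h.eq_of_correct ha hc ((hPr X hX).trans hY.symm)] at hYA
  exact ⟨X, hYA, hX⟩

/-! ### Consistency of the commit rule -/

/-- A correct node common to both voting quorums has one block in that round, and this block votes
for at most one block per slot, even if the leader equivocates. -/
theorem blockCert_unique (h : S.IsExecution correct dag) {s : ℕ} {L L' X X' : Block}
    (hL : S.LeaderOf s L) (hL' : S.LeaderOf s L') (hX : S.BlockCert X L)
    (hX' : S.BlockCert X' L') : L = L' := by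
  obtain ⟨Z, Z', ha, hc, ⟨-, hZ⟩, -, hZ'⟩ := h.quorum_inter hX.2 hX'.2
  have hr : S.round L = S.round L' := hL.2.trans hL'.2.symm
  have hZZ : Z = Z' := h.eq_of_correct ha hc (by rw [← hZ.1, ← hZ'.1, hr])
  subst hZZ
  exact hZ.eq hZ' (hL.1.trans hL'.1.symm) hr

theorem not_blockCert_of_directSkip (h : S.IsExecution correct dag) {G : Set Block} {s : ℕ}
    {L X : Block} (hL : S.LeaderOf s L) (hs : S.DirectSkip G s) : ¬ S.BlockCert X L := by
  intro hX
  obtain ⟨Z, Z', ha, hc, ⟨-, hZ⟩, -, hr, hno⟩ := h.quorum_inter hX.2 hs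
  have hZZ : Z = Z' := h.eq_of_correct ha hc (by rw [← hZ.1, hr, hL.2])
  subst hZZ
  exact hno L hL hZ

theorem exists_blockCert (h : S.IsExecution correct dag) {G : Set Block} {L : Block}
    (hd : S.DirectCommit G L) : ∃ X ∈ G, S.BlockCert X L := by
  obtain ⟨X, -, hX⟩ := h.quorum_exists hd
  exact ⟨X, hX⟩

theorem directCommit_mem_cone (h : S.IsExecution correct dag) {G : Set Block} {L A : Block}
    (hd : S.DirectCommit G L) (hA : S.round L + 3 ≤ S.round A) :
    ∃ X ∈ S.Cone A, S.BlockCert X L := by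
  obtain ⟨X, hX, -, hc⟩ := h.exists_mem_cone hd (r := S.round L + 2)
    (fun X hX => hX.2.1.symm) (A := A) (by omega)
  exact ⟨X, hX, hc⟩

/-- Any two DAGs agree on the slots that both decide. -/
theorem decides_unique (h : S.IsExecution correct dag) {G G' : Set Block} {s : ℕ}
    {d d' : Option Block} (hd : S.Decides G s d) (hd' : S.Decides G' s d') : d = d' := by
  induction hd generalizing d' with
  | directCommit s L hL hc =>
    cases hd' with
    | directCommit _ L' hL' hc' =>
      obtain ⟨X, -, hX⟩ := h.exists_blockCert hc
      obtain ⟨X', -, hX'⟩ := h.exists_blockCert hc'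
      rw [h.blockCert_unique hL hL' hX hX']
    | directSkip _ hs =>
      obtain ⟨X, -, hX⟩ := h.exists_blockCert hc
      exact absurd hX (h.not_blockCert_of_directSkip hL hs)
    | indirectCommit _ a A L' X' ha hA hskip hL' hXA hX' =>
      obtain ⟨X, -, hX⟩ := h.exists_blockCert hc
      rw [h.blockCert_unique hL hL' hX hX']
    | indirectSkip _ a A ha hA hskip hno =>
      obtain ⟨X, hXA, hX⟩ := h.directCommit_mem_cone hc (A := A)
        (by rw [hL.2, hA.leaderOf.2]; exact ha)
      exact absurd hX (hno L X hL hXA)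
  | directSkip s hs =>
    cases hd' with
    | directCommit _ L' hL' hc' =>
      obtain ⟨X, -, hX⟩ := h.exists_blockCert hc'
      exact absurd hX (h.not_blockCert_of_directSkip hL' hs)
    | directSkip _ hs => rfl
    | indirectCommit _ a A L' X' ha hA hskip hL' hXA hX' =>
      exact absurd hX' (h.not_blockCert_of_directSkip hL' hs)
    | indirectSkip _ a A ha hA hskip hno => rfl
  | indirectCommit s a A L X ha hA hskip hL hXA hX ihA ihskip =>
    cases hd' with
    | directCommit _ L' hL' hc' =>
      obtain ⟨X', -, hX'⟩ := h.exists_blockCert hc'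
      rw [h.blockCert_unique hL hL' hX hX']
    | directSkip _ hs => exact absurd hX (h.not_blockCert_of_directSkip hL hs)
    | indirectCommit _ a' A' L' X' ha' hA' hskip' hL' hXA' hX' =>
      rw [h.blockCert_unique hL hL' hX hX']
    | indirectSkip _ a' A' ha' hA' hskip' hno =>
      -- The anchors must coincide: the earlier of two different anchors would be committed in one
      -- DAG and skipped in the other, against the induction hypothesis.
      rcases lt_trichotomy a a' with hlt | rfl | hlt
      · exact absurd (ihA (hskip' a ha hlt)) (by simp)
      · cases ihA hA'
        exact absurd hX (hno L X hL hXA)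
      · exact absurd (ihskip a' ha' hlt hA') (by simp)
  | indirectSkip s a A ha hA hskip hno ihA ihskip =>
    cases hd' with
    | directCommit _ L' hL' hc' =>
      obtain ⟨X, hXA, hX⟩ := h.directCommit_mem_cone hc' (A := A)
        (by rw [hL'.2, hA.leaderOf.2]; exact ha)
      exact absurd hX (hno L' X hL' hXA)
    | directSkip _ hs => rfl
    | indirectCommit _ a' A' L' X' ha' hA' hskip' hL' hXA' hX' =>
      rcases lt_trichotomy a a' with hlt | rfl | hlt
      · exact absurd (ihA (hskip' a ha hlt)) (by simp)
      · cases ihA hA'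
        exact absurd hX' (hno L' X' hL' hXA')
      · exact absurd (ihskip a' ha' hlt hA') (by simp)
    | indirectSkip _ a' A' ha' hA' hskip' hno' => rfl

theorem backbone_unique (h : S.IsExecution correct dag) {G G' : Set Block} {s : ℕ} {L L' : Block}
    (hL : S.Backbone G s L) (hL' : S.Backbone G' s L') : L = L' :=
  Option.some.inj (h.decides_unique hL.1 hL'.1)

theorem isC_slot_unique (h : S.IsExecution correct dag) {G : Set Block} {i j j' : ℕ} {C C' : Block}
    (hC : S.IsC G i j C) (hC' : S.IsC G i j' C') : j = j' := by
  obtain ⟨L, hL, hb, hij, hd, hmin⟩ := hC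
  obtain ⟨L', hL', hb', hij', hd', hmin'⟩ := hC'
  obtain rfl := h.backbone_unique hL hL'
  by_contra hne
  rcases lt_or_gt_of_ne hne with hlt | hlt
  · exact hmin' j C hij hlt hb hd
  · exact hmin j' C' hij' hlt hb' hd'

theorem isC_unique (h : S.IsExecution correct dag) {G : Set Block} {i i' j : ℕ} {C C' : Block}
    (hC : S.IsC G i j C) (hC' : S.IsC G i' j C') : C = C' := by
  obtain ⟨L, hL, hb, -⟩ := hC
  obtain ⟨L', hL', hb', -⟩ := hC'
  exact h.backbone_unique hb hb'

/-- Uniqueness makes the choice in `newC` immaterial. -/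
theorem newC_eq_some (h : S.IsExecution correct dag) {G : Set Block} {j : ℕ} {C : Block} :
    S.newC G j = some C ↔ ∃ i, S.IsC G i j C := by
  unfold newC
  split_ifs with hex
  · obtain ⟨i, hi⟩ := hex.choose_spec
    rw [Option.some.injEq]
    exact ⟨fun hC => hC ▸ ⟨i, hi⟩, fun ⟨i', hi'⟩ => h.isC_unique hi hi'⟩
  · exact ⟨fun hC => by simp at hC, fun hC => absurd ⟨C, hC⟩ hex⟩

theorem isD_unique (h : S.IsExecution correct dag) {G : Set Block} {i : ℕ} {D D' : Block}
    (hD : S.IsD G i D) (hD' : S.IsD G i D') : D = D' := by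
  obtain ⟨j, C, d, hC, hid, hb, hc, hmin⟩ := hD
  obtain ⟨j', C', d', hC', hid', hb', hc', hmin'⟩ := hD'
  obtain rfl := h.isC_slot_unique hC hC'
  obtain rfl := h.isC_unique hC hC'
  have hdd : d = d' := by
    by_contra hne
    rcases lt_or_gt_of_ne hne with hlt | hlt
    · exact hmin' d D hid hlt hb hc
    · exact hmin d' D' hid' hlt hb' hc'
  subst hdd
  exact h.backbone_unique hb hb'

theorem dOf_eq_some (h : S.IsExecution correct dag) {G : Set Block} {i : ℕ} {D : Block} :
    S.dOf G i = some D ↔ S.IsD G i D := by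
  unfold dOf
  split_ifs with hex
  · rw [Option.some.injEq]
    exact ⟨fun hD => hD ▸ hex.choose_spec, fun hD => h.isD_unique hex.choose_spec hD⟩
  · exact ⟨fun hD => by simp at hD, fun hD => absurd ⟨D, hD⟩ hex⟩

/-! ### DAGs that decide the same slots have the same consensus path -/

theorem directCommit_round (h : S.IsExecution correct dag) {X L : Block}
    (hd : S.DirectCommit (S.Cone X) L) : S.round L + 2 ≤ S.round X := by
  obtain ⟨Y, hY, hc⟩ := h.exists_blockCert hd
  exact hc.1.le.trans (h.round_le hY)

theorem decides_round (h : S.IsExecution correct dag) {X L : Block} {s : ℕ}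
    (hd : S.Decides (S.Cone X) s (some L)) : S.slotRound s + 2 ≤ S.round X := by
  generalize ho : some L = o at hd
  induction hd generalizing L with
  | directCommit s L' hL hc =>
    rw [← hL.2]
    exact h.directCommit_round hc
  | directSkip => simp at ho
  | indirectCommit s a A L' X ha hA hskip hL hXA hX ihA ihskip =>
    have := ihA rfl
    omega
  | indirectSkip => simp at ho

theorem slot_lt (h : S.IsExecution correct dag) {i j : ℕ} (hr : S.slotRound i < S.slotRound j) :
    i < j := by
  by_contra hij
  exact absurd (h.slot_mono (not_lt.1 hij)) (not_le.2 hr)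

theorem backbone_congr (h : S.IsExecution correct dag) {G G' : Set Block} {m k : ℕ} {L : Block}
    (hG' : ∀ k ≤ m, ∃ d, S.Decides G' k d) (hk : k ≤ m) (hb : S.Backbone G k L) :
    S.Backbone G' k L := by
  refine ⟨?_, fun l hl => hG' l (hl.le.trans hk)⟩
  obtain ⟨d, hd⟩ := hG' k hk
  rw [h.decides_unique hb.1 hd]
  exact hd

/-- The commit test takes place in the cone of the candidate, independently of the ambient DAG; only
the backbone has to be transferred, backwards for the minimality clause. -/
theorem isC_congr (h : S.IsExecution correct dag) {G G' : Set Block} {m i j : ℕ} {C : Block}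
    (hG : ∀ k ≤ m, ∃ d, S.Decides G k d) (hG' : ∀ k ≤ m, ∃ d, S.Decides G' k d) (hj : j ≤ m)
    (hC : S.IsC G i j C) : S.IsC G' i j C := by
  obtain ⟨L, hL, hb, hij, hd, hmin⟩ := hC
  exact ⟨L, h.backbone_congr hG' (by omega) hL, h.backbone_congr hG' hj hb, hij, hd,
    fun k K hik hkj hK => hmin k K hik hkj (h.backbone_congr hG (by omega) hK)⟩

theorem newC_congr (h : S.IsExecution correct dag) {G G' : Set Block} {m j : ℕ}
    (hG : ∀ k ≤ m, ∃ d, S.Decides G k d) (hG' : ∀ k ≤ m, ∃ d, S.Decides G' k d) (hj : j ≤ m) :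
    S.newC G j = S.newC G' j := by
  ext C
  rw [h.newC_eq_some, h.newC_eq_some]
  exact exists_congr fun i => ⟨h.isC_congr hG hG' hj, h.isC_congr hG' hG hj⟩

theorem isD_congr (h : S.IsExecution correct dag) {G G' : Set Block} {m i j : ℕ} {C D : Block}
    (hG : ∀ k ≤ m, ∃ d, S.Decides G k d) (hG' : ∀ k ≤ m, ∃ d, S.Decides G' k d) (hj : j ≤ m)
    (hC : S.IsC G i j C) (hD : S.IsD G i D) : S.IsD G' i D := by
  obtain ⟨j', C', d, hC', hid, hb, hc, hmin⟩ := hD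
  obtain rfl := h.isC_slot_unique hC hC'
  -- A block directly committed in `Cone C` lies at least two rounds below `C`, so `D` is determined
  -- by slots before `j`.
  have hdj : d < j := by
    have h1 := h.directCommit_round hc
    obtain ⟨L, -, hbC, -⟩ := hC'
    rw [hbC.1.leaderOf.2, hb.1.leaderOf.2] at h1
    exact h.slot_lt (by omega)
  exact ⟨j, C', d, h.isC_congr hG hG' hj hC', hid, h.backbone_congr hG' (by omega) hb, hc,
    fun k K hik hkd hK => hmin k K hik hkd (h.backbone_congr hG (by omega) hK)⟩

theorem stepD_congr (h : S.IsExecution correct dag) {G G' : Set Block} {m j : ℕ}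
    (hG : ∀ k ≤ m, ∃ d, S.Decides G k d) (hG' : ∀ k ≤ m, ∃ d, S.Decides G' k d) (hj : j ≤ m) :
    S.stepD G j = S.stepD G' j := by
  funext st i
  unfold stepD
  by_cases hex : ∃ C, S.IsC G i j C
  · obtain ⟨C, hC⟩ := hex
    have hC' := h.isC_congr hG hG' hj hC
    have hd : S.dOf G i = S.dOf G' i := by
      ext D
      rw [h.dOf_eq_some, h.dOf_eq_some]
      exact ⟨h.isD_congr hG hG' hj hC, h.isD_congr hG' hG hj hC'⟩
    rw [if_pos ⟨C, hC⟩, if_pos ⟨C, hC'⟩, hd]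
  · rw [if_neg hex, if_neg fun ⟨C, hC⟩ => hex ⟨C, h.isC_congr hG' hG hj hC⟩]

theorem consState_congr (h : S.IsExecution correct dag) {G G' : Set Block} {m : ℕ}
    (hG : ∀ k ≤ m, ∃ d, S.Decides G k d) (hG' : ∀ k ≤ m, ∃ d, S.Decides G' k d) :
    ∀ j ≤ m + 1, S.consState G j = S.consState G' j := by
  intro j
  induction j with
  | zero => exact fun _ => rfl
  | succ j ih =>
    intro hj
    simp only [consState]
    rw [h.newC_congr hG hG' (by omega : j ≤ m), h.stepD_congr hG hG' (by omega : j ≤ m),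
      ih (by omega)]

/-- What the consensus path confirms in the cone of a block `B` is confirmed by every DAG before it
processes a leader block whose round is at least that of `B`. -/
theorem consState_cone_subset (h : S.IsExecution correct dag) {G : Set Block} {j j' : ℕ}
    {B C : Block} (hC : S.Backbone G j C) (hr : S.round B ≤ S.round C) {p : Tx}
    (hp : p ∈ (S.consState (S.Cone B) j').1) : p ∈ (S.consState G j).1 := by
  induction j' with
  | zero => exact absurd hp (by simp [consState])
  | succ j' ih =>
    cases hn : S.newC (S.Cone B) j' with
    | none =>
      simp only [consState, hn] at hp
      exact ih hp
    | some C' =>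
      obtain ⟨i, L, -, hb, -⟩ := h.newC_eq_some.1 hn
      have h1 := h.decides_round hb.1
      have h2 := hC.1.leaderOf.2
      -- A block committed in `Cone B` is at least two rounds below `B`, hence strictly below `C`,
      -- so its slot precedes `j` and is decided in `G` as well.
      have hlt : j' < j := h.slot_lt (by omega)
      have hB : ∀ k ≤ j', ∃ d, S.Decides (S.Cone B) k d := fun k hk => by
        rcases hk.lt_or_eq with hk | rfl
        · exact hb.2 k hk
        · exact ⟨_, hb.1⟩
      have hG : ∀ k ≤ j', ∃ d, S.Decides G k d := fun k hk => hC.2 k (by omega)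
      rw [h.consState_congr hB hG (j' + 1) le_rfl] at hp
      exact consState_mono G (Nat.succ_le_of_lt hlt) hp

/-! ### Safety of the fast path -/

theorem fastConfirmed_exists (h : S.IsExecution correct dag) {G : Set Block} {B : Block} {tx : Tx}
    (hf : S.FastConfirmed G B tx) : ∃ X ∈ G, S.TxCert X B tx := by
  obtain ⟨X, -, hX⟩ := h.quorum_exists hf
  exact ⟨X, hX⟩

theorem txCert_approves (h : S.IsExecution correct dag) {X B : Block} {tx : Tx}
    (hX : S.TxCert X B tx) : ∃ Y ∈ S.Cone X, S.Approves Y B tx := by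
  obtain ⟨Y, hc, hY, hv⟩ := h.quorum_exists hX.2
  exact ⟨Y, hY, h.correct_votes Y B tx hc hv⟩

/-- Double spends are not both certified. -/
theorem txCert_not_doubleSpend (h : S.IsExecution correct dag) {X X' B B' : Block} {tx tx' : Tx}
    (hX : S.TxCert X B tx) (hX' : S.TxCert X' B' tx') : ¬ S.DoubleSpend tx tx' := by
  intro hds
  obtain ⟨Y, Y', ha, hc, ⟨-, hY⟩, -, hY'⟩ := h.quorum_inter hX.2 hX'.2
  have h1 := h.correct_votes _ _ _ hc hY
  have h2 := h.correct_votes _ _ _ (ha ▸ hc) hY'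
  -- The later of the two voting blocks has the other in its cone, hence sees both transactions and
  -- could not have voted.
  rcases le_total (S.round Y) (S.round Y') with hle | hle
  · have hm := h.correct_linear Y' Y ha.symm (ha ▸ hc) hle
    exact h2.2.2.2 B (mem_cone_trans hm h1.1) tx h1.2.1 hds.symm
  · have hm := h.correct_linear Y Y' ha hc hle
    exact h1.2.2.2 B' (mem_cone_trans hm h2.1) tx' h2.2.1 hds

theorem eligible_of_fastConfirmed (h : S.IsExecution correct dag) {G : Set Block} {B C : Block}
    {tx : Tx} (hf : S.FastConfirmed G B tx) (hr : S.round B + 3 ≤ S.round C) :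
    S.Eligible C B tx := by
  obtain ⟨X, hX, -, hc⟩ := h.exists_mem_cone hf (r := S.round B + 2)
    (fun X hX => hX.2.1.symm) (A := C) (by omega)
  exact ⟨hr, X, hX, hc⟩

/-- Among the votes in a certificate one is by a correct node, which guarantees that `B` contains
`tx` and lies in the cone. -/
theorem mem_entries_of_eligible (h : S.IsExecution correct dag) {B C : Block} {tx : Tx}
    (he : S.Eligible C B tx) : (B, tx) ∈ S.entries C := by
  obtain ⟨-, X, hX, hc⟩ := he
  obtain ⟨Y, hY, ha⟩ := h.txCert_approves hc
  exact mem_entries.2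
    ⟨(h.order_mem C B).2 (mem_cone_trans hX (mem_cone_trans hY ha.1)), ha.2.1⟩

/-- In the agreed order, transactions in the causal history of a block come first. -/
theorem mem_pre_of_mem_cone (h : S.IsExecution correct dag) {B B' C : Block} {tx p : Tx}
    {pre post : List (Block × Tx)} (hent : S.entries C = pre ++ (B, tx) :: post)
    (hp : (B', p) ∈ S.entries C) (hB : B' ∈ S.Cone B) (hne : B' ≠ B) : (B', p) ∈ pre := by
  -- The second alternative accounts for several transactions in one block, which lies in its own
  -- cone.
  have hpw : (S.entries C).Pairwise (fun e e' => e'.1 ∉ S.Cone e.1 ∨ e'.1 = e.1) := by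
    unfold entries
    rw [List.pairwise_flatMap]
    refine ⟨fun Y _ => ?_, (h.order_causal C).imp fun {Y Z} hYZ e he e' he' => ?_⟩
    · rw [List.pairwise_map]
      exact List.pairwise_of_forall fun _ _ => Or.inr rfl
    · obtain ⟨t, -, rfl⟩ := List.mem_map.1 he
      obtain ⟨t', -, rfl⟩ := List.mem_map.1 he'
      exact Or.inl hYZ
  rw [hent] at hpw hp
  rcases List.mem_append.1 hp with h1 | h1
  · exact h1
  rcases List.mem_cons.1 h1 with h1 | h1
  · exact absurd (Prod.mk.inj h1).1 hne
  · rcases List.rel_of_pairwise_cons (List.pairwise_append.1 hpw).2.1 h1 with h2 | h2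
    · exact absurd hB h2
    · exact absurd h2 hne

theorem conflictFree_foldl_step2a (h : S.IsExecution correct dag) {K : Set Tx}
    (hK : S.ConflictFree K) (C : Block) (l : List (Block × Tx)) :
    S.ConflictFree (l.foldl (S.step2a C) K) := by
  intro G B tx hf tx' htx'
  rcases mem_foldl_step2a l htx' with h1 | ⟨B', -, X', -, hX'⟩
  · exact hK G B tx hf tx' h1
  · obtain ⟨X, -, hX⟩ := h.fastConfirmed_exists hf
    exact h.txCert_not_doubleSpend hX hX'

/-- A fast-path confirmed transaction can be confirmed at its turn in path 2a. -/
theorem possible_of_fastConfirmed (h : S.IsExecution correct dag) {G : Set Block} {j : ℕ}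
    {C : Block} (hC : S.Backbone G j C) (hK : S.ConflictFree (S.consState G j).1) :
    ∀ {G' : Set Block} {B : Block} {tx : Tx}, S.FastConfirmed G' B tx →
      S.round B + 3 ≤ S.round C → ∀ {pre post : List (Block × Tx)},
      S.entries C = pre ++ (B, tx) :: post →
      S.Possible (pre.foldl (S.step2a C) (S.consState G j).1) tx := by
  suffices ∀ n, ∀ {G' : Set Block} {B : Block} {tx : Tx}, S.round B = n →
      S.FastConfirmed G' B tx → S.round B + 3 ≤ S.round C →
      ∀ {pre post : List (Block × Tx)}, S.entries C = pre ++ (B, tx) :: post →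
      S.Possible (pre.foldl (S.step2a C) (S.consState G j).1) tx from
    fun {G' B tx} => this (S.round B) rfl
  intro n
  induction n using Nat.strong_induction_on with
  | _ n ih =>
  intro G' B tx hn hf hr pre post hent
  refine ⟨fun o ho => ?_, h.conflictFree_foldl_step2a hK C pre G' B tx hf⟩
  obtain ⟨X, -, hX⟩ := h.fastConfirmed_exists hf
  obtain ⟨Y, -, -, -, hin, -⟩ := h.txCert_approves hX
  refine (hin o ho).imp_right fun ⟨p, hp, hop⟩ => ⟨p, ?_, hop⟩
  -- If the fast path of `Cone B` confirmed the parent `p`, its block `B'` is at least two rounds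
  -- below `B` and comes earlier in the traversal, so the induction hypothesis applies to `B'`.
  -- Otherwise the consensus state before `C` already contains `p`.
  rcases hp with ⟨B', hf'⟩ | ⟨j', hp⟩
  · obtain ⟨X', hXB, hX'⟩ := h.fastConfirmed_exists hf'
    have h1 := h.round_le hXB
    have h2 := hX'.1
    obtain ⟨Y', hY', hB', -⟩ := h.txCert_approves hX'
    have hel := h.eligible_of_fastConfirmed hf' (C := C) (by omega)
    have hmem := h.mem_pre_of_mem_cone hent (h.mem_entries_of_eligible hel)
      (mem_cone_trans hXB (mem_cone_trans hY' hB')) (by rintro rfl; omega)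
    obtain ⟨pre', post', rfl⟩ := List.append_of_mem hmem
    have hpos := ih _ (by omega) rfl hf' (by omega) (pre := pre')
      (post := post' ++ (B, tx) :: post) (by simpa using hent)
    rw [List.foldl_append, List.foldl_cons]
    exact subset_foldl_step2a C _ _ (Or.inr ⟨rfl, hel, hpos⟩)
  · exact subset_foldl_step2a C _ _ (h.consState_cone_subset hC (by omega) hp)

theorem mem_pass2a_of_fastConfirmed (h : S.IsExecution correct dag) {G G' : Set Block} {j : ℕ}
    {B C : Block} {tx : Tx} (hC : S.Backbone G j C) (hK : S.ConflictFree (S.consState G j).1)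
    (hf : S.FastConfirmed G' B tx) (hr : S.round B + 3 ≤ S.round C) :
    tx ∈ S.pass2a C (S.consState G j).1 := by
  have hel := h.eligible_of_fastConfirmed hf hr
  obtain ⟨pre, post, hent⟩ := List.append_of_mem (h.mem_entries_of_eligible hel)
  rw [pass2a, hent, List.foldl_append, List.foldl_cons]
  exact subset_foldl_step2a C _ _
    (Or.inr ⟨rfl, hel, h.possible_of_fastConfirmed hC hK hf hr hent⟩)

/-- A block directly committed in the cone of a block which is at most two rounds above `B` has no
double spend of a fast-path confirmed transaction in `B` in its causal history. -/
theorem not_doubleSpend_of_directCommit (h : S.IsExecution correct dag) {G : Set Block}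
    {B C D Y : Block} {tx tx' : Tx} (hf : S.FastConfirmed G B tx)
    (hD : S.DirectCommit (S.Cone C) D) (hr : S.round C ≤ S.round B + 2) (hY : Y ∈ S.Cone D)
    (htx' : tx' ∈ S.txs Y) : ¬ S.DoubleSpend tx tx' := by
  obtain ⟨X, -, hX⟩ := h.fastConfirmed_exists hf
  obtain ⟨W, -, hW⟩ := h.exists_blockCert hD
  obtain ⟨V, Z, ha, hc, ⟨-, hV⟩, -, hZ⟩ := h.quorum_inter hX.2 hW.2
  have hap := h.correct_votes V B tx hc hV
  have hDC := h.directCommit_round hD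
  have hBV := h.round_le hap.1
  suffices D ∈ S.Cone V from hap.2.2.2 Y (mem_cone_trans this hY) tx' htx'
  -- `V` votes for `tx`, `Z` votes for `D`, and both belong to one correct node. Since `D` is not
  -- above `B`, and `B` is not above `V`, `Z` can exceed `V` only if `V`, `B` and `D` share a round
  -- and `C` is exactly two rounds above.
  by_cases hle : S.round Z ≤ S.round V
  · exact mem_cone_trans (h.correct_linear V Z ha hc hle) hZ.mem_cone
  -- here `C` is the only certificate for `D` in its own cone, so that there is only one node
  have hZD := hZ.1
  have hsub : {v : Node | ∃ X, S.author X = v ∧ X ∈ S.Cone C ∧ S.BlockCert X D} ⊆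
      {S.author C} := by
    rintro v ⟨X, rfl, hXC, hXD⟩
    have := hXD.1
    rw [h.eq_of_mem_cone hXC (by omega)]
    rfl
  have hcard := (show 2 * S.f + 1 ≤ _ from hD).trans (Set.ncard_le_ncard hsub)
  rw [Set.ncard_singleton] at hcard
  have hone : Nat.card Node = 1 := by rw [h.card_nodes]; omega
  have : Subsingleton Node := (Nat.card_eq_one_iff_unique.1 hone).1
  exact h.correct_linear V D (Subsingleton.elim _ _) hc (by omega)

/-- `hin` records the outcome of path 2a for `C`, which is why 2a has to run before 2b. -/
theorem conflictFree_stepD (h : S.IsExecution correct dag) {G : Set Block} {i j : ℕ}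
    {C : Block} (hnew : S.newC G j = some C) {st : Set Tx × Set Block}
    (hK : S.ConflictFree st.1)
    (hin : ∀ G' B tx, S.FastConfirmed G' B tx → S.round B + 3 ≤ S.round C → tx ∈ st.1) :
    S.ConflictFree (S.stepD G j st i).1 := by
  unfold stepD
  split_ifs with hex
  · split
    · rename_i D hD
      split_ifs
      · exact hK
      · obtain ⟨C', hC'⟩ := hex
        obtain ⟨i₀, hC⟩ := h.newC_eq_some.1 hnew
        obtain rfl := h.isC_unique hC hC'
        obtain ⟨j'', C'', d, hC'', -, -, hcD, -⟩ := h.dOf_eq_some.1 hD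
        obtain rfl := h.isC_slot_unique hC' hC''
        obtain rfl := h.isC_unique hC' hC''
        suffices ∀ l : List (Block × Tx), l ⊆ S.entries D → ∀ K, st.1 ⊆ K → S.ConflictFree K →
            S.ConflictFree (l.foldl S.step2b K) from this _ (List.Subset.refl _) _ subset_rfl hK
        intro l
        induction l with
        | nil => exact fun _ K _ hK => hK
        | cons e l ih =>
          intro hl K hsub hK
          refine ih (List.subset_of_cons_subset hl) _ (fun x hx => Or.inl (hsub hx)) ?_
          rintro G' B tx hf tx' (h1 | ⟨rfl, hpos⟩) hds
          · exact hK G' B tx hf tx' h1 hds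
          -- When `C` is high enough, `tx` is already confirmed and blocks `tx'`; otherwise `tx'`
          -- cannot occur in `Cone D` at all.
          · by_cases hr : S.round B + 3 ≤ S.round C
            · exact hpos.2 tx (hsub (hin G' B tx hf hr)) hds.symm
            · obtain ⟨hY, htx⟩ := mem_entries.1 (hl List.mem_cons_self)
              exact h.not_doubleSpend_of_directCommit hf hcD (by omega)
                ((h.order_mem _ _).1 hY) htx hds
    · exact hK
  · exact hK

/-- The consensus path never confirms a double spend of a fast-path confirmed transaction. -/
theorem conflictFree_consState (h : S.IsExecution correct dag) (G : Set Block) (j : ℕ) :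
    S.ConflictFree (S.consState G j).1 := by
  induction j with
  | zero => exact fun _ _ _ _ tx' htx' => absurd htx' (by simp [consState])
  | succ j ih =>
    cases hn : S.newC G j with
    | none =>
      simp only [consState, hn]
      exact ih
    | some C =>
      simp only [consState, hn]
      obtain ⟨i, L, -, hb, -⟩ := h.newC_eq_some.1 hn
      -- The invariant of the 2b steps pairs conflict-freeness with the presence of all fast-path
      -- transactions at least three rounds below `C`.
      suffices ∀ (l : List ℕ) (st : Set Tx × Set Block), S.ConflictFree st.1 →
          (∀ G' B tx, S.FastConfirmed G' B tx → S.round B + 3 ≤ S.round C → tx ∈ st.1) →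
          S.ConflictFree (l.foldl (S.stepD G j) st).1 from
        this _ _ (h.conflictFree_foldl_step2a ih C _)
          fun G' B tx hf hr => h.mem_pass2a_of_fastConfirmed hb ih hf hr
      intro l
      induction l with
      | nil => exact fun st hst _ => hst
      | cons i l ih =>
        exact fun st hst hin => ih _ (h.conflictFree_stepD hn hst hin)
          fun G' B tx hf hr => subset_stepD G j st i (hin G' B tx hf hr)

theorem confirmed2aAt_of_fastConfirmed (h : S.IsExecution correct dag) {G G' : Set Block} {j : ℕ}
    {B C : Block} {tx : Tx} (hnew : S.newC G j = some C) (hf : S.FastConfirmed G' B tx)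
    (hr : S.round B + 3 ≤ S.round C) : S.Confirmed2aAt G j C B tx := by
  have hel := h.eligible_of_fastConfirmed hf hr
  obtain ⟨pre, post, hent⟩ := List.append_of_mem (h.mem_entries_of_eligible hel)
  obtain ⟨i, L, -, hb, -⟩ := h.newC_eq_some.1 hnew
  exact ⟨hnew, hel, pre, post, hent,
    h.possible_of_fastConfirmed hb (h.conflictFree_consState G j) hf hr hent⟩

theorem not_confirmed_of_doubleSpend (h : S.IsExecution correct dag) {G G' : Set Block} {B : Block}
    {tx tx' : Tx} (hf : S.FastConfirmed G' B tx) (hds : S.DoubleSpend tx tx') :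
    ¬ S.Confirmed G tx' := by
  rintro (⟨B', hf'⟩ | ⟨j, hj⟩)
  · obtain ⟨X, -, hX⟩ := h.fastConfirmed_exists hf
    obtain ⟨X', -, hX'⟩ := h.fastConfirmed_exists hf'
    exact h.txCert_not_doubleSpend hX hX' hds
  · exact h.conflictFree_consState G j G' B tx hf tx' hj hds

/-! ### Liveness -/

/-- A correct creator has a single block per round, so the traversal can meet no competitor of `Y`
first. -/
theorem blockVote_of_mem_refs (h : S.IsExecution correct dag) {X Y : Block} (hY : Y ∈ S.refs X)
    (hr : S.round X = S.round Y + 1) (hc : S.author Y ∈ correct) : S.BlockVote X Y := by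
  classical
  refine ⟨hr.symm, ?_⟩
  have hmem : Y ∈ S.dfs X := by
    rw [dfs, hr, dfsAux]
    exact List.mem_cons_of_mem _ (List.mem_flatMap.2 ⟨Y, hY, self_mem_dfsAux _ _⟩)
  cases hfind : (S.dfs X).find?
      (fun Z => decide (S.author Z = S.author Y ∧ S.round Z = S.round Y)) with
  | none =>
    have := List.find?_eq_none.1 hfind Y hmem
    simp at this
  | some Z =>
    have hZ := List.find?_some hfind
    simp only [decide_eq_true_eq] at hZ
    rw [h.eq_of_correct hZ.1 (hZ.1 ▸ hc) hZ.2]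

/-- After stabilization, the blocks of correct nodes certify the blocks of correct nodes. -/
theorem blockCert_of_synchronous (h : S.IsExecution correct dag)
    (hs : S.EventuallySynchronous correct dag) {gst : ℕ}
    (hgst : ∀ X Y, S.author X ∈ correct → S.author Y ∈ correct →
      gst ≤ S.round Y → S.round X = S.round Y + 1 → Y ∈ S.refs X)
    {X L : Block} (hX : S.author X ∈ correct) (hL : S.author L ∈ correct) (hr : gst ≤ S.round L)
    (hXL : S.round X = S.round L + 2) : S.BlockCert X L := by
  refine ⟨hXL.symm, h.quorum_of_correct fun v hv => ?_⟩
  obtain ⟨Z, rfl, hZ⟩ := hs.produces v hv (S.round L + 1)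
  exact ⟨Z, rfl, mem_cone_of_mem_refs (hgst X Z hX hv (by omega) (by omega)),
    h.blockVote_of_mem_refs (hgst Z L hv hL hr hZ) hZ hL⟩

/-- Each correct node's block two rounds above `L` is a certificate; as there are finitely many
nodes, these blocks have all reached `u` after the largest delivery time. -/
theorem exists_directCommit (h : S.IsExecution correct dag)
    (hs : S.EventuallySynchronous correct dag) {gst : ℕ}
    (hgst : ∀ X Y, S.author X ∈ correct → S.author Y ∈ correct →
      gst ≤ S.round Y → S.round X = S.round Y + 1 → Y ∈ S.refs X)
    {L : Block} (hL : S.author L ∈ correct) (hr : gst ≤ S.round L) {u : Node} (hu : u ∈ correct) :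
    ∃ T, ∀ t ≥ T, S.DirectCommit (dag u t) L := by
  have := h.finite_node
  have hex : ∀ v : Node, ∃ T, v ∈ correct →
      ∃ X, S.author X = v ∧ S.round X = S.round L + 2 ∧ X ∈ dag u T := fun v => by
    by_cases hv : v ∈ correct
    · obtain ⟨X, rfl, hX⟩ := hs.produces v hv (S.round L + 2)
      obtain ⟨T, hT⟩ := hs.delivers X hv u hu
      exact ⟨T, fun _ => ⟨X, rfl, hX, hT⟩⟩
    · exact ⟨0, fun hv' => absurd hv' hv⟩
  choose T hT using hex
  obtain ⟨M, hM⟩ := (Set.finite_range T).bddAbove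
  refine ⟨M, fun t ht => h.quorum_of_correct fun v hv => ?_⟩
  obtain ⟨X, rfl, hX, hXT⟩ := hT v hv
  exact ⟨X, rfl, h.dag_mono u hu ((hM ⟨_, rfl⟩).trans ht) hXT,
    h.blockCert_of_synchronous hs hgst hv hL hr hX⟩

/-- A slot is decided if all slots between it and a committed slot at least three rounds later
are decided, as far as they are at least three rounds later themselves. -/
theorem exists_decides {G : Set Block} {s a : ℕ} {A : Block}
    (ha : S.slotRound s + 3 ≤ S.slotRound a) (hA : S.Decides G a (some A))
    (hdec : ∀ k, S.slotRound s + 3 ≤ S.slotRound k → k < a → ∃ d, S.Decides G k d) :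
    ∃ d, S.Decides G s d := by
  classical
  have hex : ∃ b, S.slotRound s + 3 ≤ S.slotRound b ∧ ∃ K, S.Decides G b (some K) := ⟨a, ha, A, hA⟩
  -- The first committed candidate is the anchor: the candidates before it are decided but not
  -- committed, hence skipped.
  obtain ⟨hb, K, hK⟩ := Nat.find_spec hex
  have hmin : ∀ k, S.slotRound s + 3 ≤ S.slotRound k → k < Nat.find hex → S.Decides G k none := by
    intro k hk hlt
    obtain ⟨d, hd⟩ := hdec k hk (hlt.trans_le (Nat.find_min' hex ⟨ha, A, hA⟩))
    cases d with
    | none => exact hd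
    | some K' => exact absurd ⟨hk, K', hd⟩ (Nat.find_min hex hlt)
  by_cases hcert : ∃ L X, S.LeaderOf s L ∧ X ∈ S.Cone K ∧ S.BlockCert X L
  · obtain ⟨L, X, hL, hX, hc⟩ := hcert
    exact ⟨_, Decides.indirectCommit s _ K L X hb hK hmin hL hX hc⟩
  · exact ⟨_, Decides.indirectSkip s _ K hb hK hmin
      fun L X hL hX hc => hcert ⟨L, X, hL, hX, hc⟩⟩

/-- If the first slots of three consecutive rounds are committed, then all earlier slots are
decided. -/
theorem exists_decides_of_three (h : S.IsExecution correct dag) {G : Set Block} {R : ℕ} {a : ℕ → ℕ}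
    (ha : ∀ k < 3, S.slotRound (a k) = R + k)
    (hfirst : ∀ k < 3, ∀ s, S.slotRound s = R + k → a k ≤ s)
    (hA : ∀ k < 3, ∃ A, S.Decides G (a k) (some A)) :
    ∀ s < a 0, ∃ d, S.Decides G s d := by
  -- Induction downwards from slot `a 0`; `n` counts the slots strictly between.
  suffices ∀ n s, a 0 = s + n + 1 → ∃ d, S.Decides G s d from
    fun s hs => this (a 0 - (s + 1)) s (by omega)
  intro n
  induction n using Nat.strong_induction_on with
  | _ n ih =>
  intro s hs
  have h0 := ha 0 (by omega)
  have hsR : S.slotRound s < R := by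
    have h1 : S.slotRound s ≤ S.slotRound (a 0) := h.slot_mono (by omega)
    by_contra hlt
    have := hfirst 0 (by omega) s (by omega)
    omega
  by_cases hfar : S.slotRound s + 3 ≤ R
  · obtain ⟨A, hA0⟩ := hA 0 (by omega)
    refine exists_decides (by omega) hA0 fun k hk hka => ?_
    have hsk : s < k := h.slot_lt (by omega)
    exact ih (a 0 - (k + 1)) (by omega) k (by omega)
  -- For the three rounds just below `R`, the slot `a k` is the very first candidate anchor, so
  -- nothing before it has to be decided. This is why three consecutive leaders are needed.
  · obtain ⟨k, hk⟩ : ∃ k, S.slotRound s + 3 = R + k := ⟨S.slotRound s + 3 - R, by omega⟩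
    have hk3 : k < 3 := by omega
    obtain ⟨A, hAk⟩ := hA k hk3
    refine exists_decides (by rw [ha k hk3, hk]) hAk fun l hl hlk => ?_
    have h1 : S.slotRound l ≤ S.slotRound (a k) := h.slot_mono hlk.le
    have h2 := ha k hk3
    have := hfirst k hk3 l (by omega)
    omega

/-- Under fair scheduling and eventual synchrony, blocks of correct leaders of arbitrarily high
rounds enter the backbone chain of every correct node. -/
theorem exists_backbone (h : S.IsExecution correct dag)
    (hs : S.EventuallySynchronous correct dag) (hfair : S.FairSchedule correct) {gst : ℕ}
    (hgst : ∀ X Y, S.author X ∈ correct → S.author Y ∈ correct →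
      gst ≤ S.round Y → S.round X = S.round Y + 1 → Y ∈ S.refs X)
    {u : Node} (hu : u ∈ correct) (R₀ : ℕ) :
    ∃ i L, S.LeaderOf i L ∧ S.author L ∈ correct ∧ gst ≤ S.round L ∧ R₀ ≤ S.round L ∧
      ∃ T, ∀ t ≥ T, S.Backbone (dag u t) i L := by
  obtain ⟨R, hR, hslots⟩ := hfair (max gst R₀)
  have hgR : gst ≤ R := (le_max_left _ _).trans hR
  have hRR : R₀ ≤ R := (le_max_right _ _).trans hR
  have hslots' : ∀ k, ∃ s, k < 3 → S.slotRound s = R + k ∧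
      (∀ s', S.slotRound s' = R + k → s ≤ s') ∧ S.slotNode s ∈ correct := fun k => by
    by_cases hk : k < 3
    · obtain ⟨s, hs⟩ := hslots k hk
      exact ⟨s, fun _ => hs⟩
    · exact ⟨0, fun hk' => absurd hk' hk⟩
  choose a ha using hslots'
  have hlead : ∀ k < 3, ∃ L, S.LeaderOf (a k) L ∧ ∃ T, ∀ t ≥ T, S.DirectCommit (dag u t) L := by
    intro k hk
    obtain ⟨h1, -, h3⟩ := ha k hk
    obtain ⟨L, hLa, hLr⟩ := hs.produces _ h3 (R + k)
    exact ⟨L, ⟨hLa, hLr.trans h1.symm⟩,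
      h.exists_directCommit hs hgst (hLa ▸ h3) (by omega) hu⟩
  obtain ⟨L0, hL0, T0, hT0⟩ := hlead 0 (by omega)
  obtain ⟨L1, hL1, T1, hT1⟩ := hlead 1 (by omega)
  obtain ⟨L2, hL2, T2, hT2⟩ := hlead 2 (by omega)
  obtain ⟨hr0, -, hc0⟩ := ha 0 (by omega)
  have hrL : S.round L0 = R := hL0.2.trans hr0
  refine ⟨a 0, L0, hL0, hL0.1 ▸ hc0, by omega, by omega, max T0 (max T1 T2), fun t ht => ?_⟩
  have hd0 := Decides.directCommit _ _ hL0 (hT0 t (by omega))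
  have hd1 := Decides.directCommit _ _ hL1 (hT1 t (by omega))
  have hd2 := Decides.directCommit _ _ hL2 (hT2 t (by omega))
  refine ⟨hd0, h.exists_decides_of_three (fun k hk => (ha k hk).1)
    (fun k hk => (ha k hk).2.1) fun k hk => ?_⟩
  interval_cases k
  exacts [⟨_, hd0⟩, ⟨_, hd1⟩, ⟨_, hd2⟩]

/-- The block `W` of the creator of `A`, three rounds above `L`, references all correct certificates
for `L` and lies in `Cone A`. -/
theorem directCommit_cone_of_synchronous (h : S.IsExecution correct dag)
    (hs : S.EventuallySynchronous correct dag) {gst : ℕ}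
    (hgst : ∀ X Y, S.author X ∈ correct → S.author Y ∈ correct →
      gst ≤ S.round Y → S.round X = S.round Y + 1 → Y ∈ S.refs X)
    {L A : Block} (hL : S.author L ∈ correct) (hA : S.author A ∈ correct)
    (hr : gst ≤ S.round L) (hLA : S.round L + 3 ≤ S.round A) : S.DirectCommit (S.Cone A) L := by
  obtain ⟨W, hWa, hW⟩ := hs.produces _ hA (S.round L + 3)
  have hWA : W ∈ S.Cone A := h.correct_linear A W hWa.symm hA (by omega)
  refine h.quorum_of_correct fun v hv => ?_
  obtain ⟨X, rfl, hX⟩ := hs.produces v hv (S.round L + 2)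
  exact ⟨X, rfl, mem_cone_trans hWA (mem_cone_of_mem_refs
    (hgst W X (hWa ▸ hA) hv (by omega) (by omega))),
    h.blockCert_of_synchronous hs hgst hv hL hr hX⟩

theorem exists_isC {G : Set Block} {i j : ℕ} {L A : Block}
    (hL : S.Backbone G i L) (hA : S.Backbone G j A) (hij : i < j)
    (hd : S.Decides (S.Cone A) i (some L)) : ∃ k C, S.IsC G i k C := by
  classical
  have hex : ∃ k, i < k ∧ ∃ C, S.Backbone G k C ∧ S.Decides (S.Cone C) i (some L) :=
    ⟨j, hij, A, hA, hd⟩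
  obtain ⟨hik, C, hC, hdC⟩ := Nat.find_spec hex
  exact ⟨_, C, L, hL, hC, hik, hdC,
    fun k K hk hlt hK hdK => Nat.find_min hex hlt ⟨hk, K, hK, hdK⟩⟩

/-- Blocks `C(L)` of arbitrarily high rounds are eventually processed by every correct node. -/
theorem exists_newC (h : S.IsExecution correct dag)
    (hs : S.EventuallySynchronous correct dag) (hfair : S.FairSchedule correct)
    {u : Node} (hu : u ∈ correct) (R₀ : ℕ) :
    ∃ T, ∀ t ≥ T, ∃ j C, S.newC (dag u t) j = some C ∧ R₀ ≤ S.round C := by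
  obtain ⟨gst, hgst⟩ := hs.synchronous
  obtain ⟨i, L, hiL, hcL, hgL, hrL, T, hT⟩ := h.exists_backbone hs hfair hgst hu R₀
  obtain ⟨j, A, hjA, hcA, -, hrA, T', hT'⟩ :=
    h.exists_backbone hs hfair hgst hu (S.round L + 3)
  have hij : i < j := h.slot_lt (by rw [← hiL.2, ← hjA.2]; omega)
  have hd := Decides.directCommit i L hiL
    (h.directCommit_cone_of_synchronous hs hgst hcL hcA hgL hrA)
  refine ⟨max T T', fun t ht => ?_⟩
  obtain ⟨k, C, hC⟩ := exists_isC (hT t (by omega)) (hT' t (by omega)) hij hd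
  refine ⟨k, C, h.newC_eq_some.2 ⟨i, hC⟩, ?_⟩
  obtain ⟨-, -, hbC, hik, -⟩ := hC
  -- `C(L)` may come before `A`, but it comes after `L`, whose round is already at least `R₀`.
  have h1 : S.slotRound i ≤ S.slotRound k := h.slot_mono hik.le
  rw [hbC.1.leaderOf.2]
  exact (hrL.trans hiL.2.le).trans h1

end IsExecution

end Setup

end MysticetiFPC

theorem mainTheorem6 {Node Tx Obj Block : Type*}
    (S : MysticetiFPC.Setup Node Tx Obj Block)
    (correct : Set Node) (dag : Node → ℕ → Set Block)
    (hexec : S.IsExecution correct dag)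
    (v : Node) (hv : v ∈ correct) (t₀ : ℕ) (B : Block) (tx : Tx)
    (hfast : S.FastConfirmed (dag v t₀) B tx) :
    (∀ u ∈ correct, ∀ t j C, S.newC (dag u t) j = some C → S.round B + 3 ≤ S.round C →
      S.Confirmed2aAt (dag u t) j C B tx) ∧
    (∀ u ∈ correct, ∀ t tx', S.DoubleSpend tx tx' → ¬ S.Confirmed (dag u t) tx') ∧
    (S.EventuallySynchronous correct dag → S.FairSchedule correct →
      ∀ u ∈ correct, ∃ T, ∀ t ≥ T, S.Confirmed2a (dag u t) B tx) := by
  refine ⟨fun u _ t j C hnew hr => hexec.confirmed2aAt_of_fastConfirmed hnew hfast hr,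
    fun u _ t tx' hds => hexec.not_confirmed_of_doubleSpend hfast hds, fun hs hfair u hu => ?_⟩
  obtain ⟨T, hT⟩ := hexec.exists_newC hs hfair hu (S.round B + 3)
  refine ⟨T, fun t ht => ?_⟩
  obtain ⟨j, C, hnew, hr⟩ := hT t ht
  exact ⟨j, C, hexec.confirmed2aAt_of_fastConfirmed hnew hfast hr⟩
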